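/- Let $d\ge 2$, let $\Omega\subset\mathbb R^d$ be open, $x_0\in\Omega$, and let $D_0\in C^\infty(\overline\Omega)$ with $D_0\ge C_0'>0$. Let $B\subset\mathbb R^d$ be a bounded measurable set (in particular, a bounded domain with Lipschitz boundary), and let $D_1\in L^\infty(\mathbb R^d)$ vanish a.e. outside $\overline B$. Assume that there are $C_0>0$ and $\varepsilon_0>0$ such that for every $0<\varepsilon<\varepsilon_0$ $$D_0(x)+D_1\Big(\frac{x-x_0}{\varepsilon}\Big)\ge C_0\qquad\text{for a.e. } x\in\Omega .$$ For a multi-index $j\in\mathbb N^d$ write $x^j=x_1^{j_1}\cdots x_d^{j_d}$. A corrector of index $j$ is a function $\phi_j\in H^1_{\rm loc}(\mathbb R^d)\cap C^\infty(\mathbb R^d\setminus\overline B)$ with $\phi_j(x)=O(|x|^{1-d})$ as $|x|\to\infty$ and $$\nabla\cdot\big((D_0(x_0)+D_1)\nabla\phi_j\big)=-\nabla\cdot\big(\mathbf 1_B D_1\nabla x^j\big)\quad\text{in }\mathcal D'(\mathbb R^d),$$ that is, $$\int_{\mathbb R^d}(D_0(x_0)+D_1)\nabla\phi_j\cdot\nabla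 v\,dx=-\int_B D_1\nabla x^j\cdot\nabla v\,dx\qquad\text{for all } v\in C_c^\infty(\mathbb R^d).$$ Let $I\subset\mathbb N^d$ be a finite set of multi-indices, let $\phi_j$ be a corrector of index $j$ for each $j\in I$, and define the polarization tensor $$M_{ij}=\int_B D_1\,\nabla(x^j+\phi_j)\cdot\nabla x^i\,dx,\qquad i,j\in I .$$ Then, for all real numbers $\alpha_i,\beta_i$ $(i\in I)$: (i) $\displaystyle\sum_{i,j\in I}\alpha_i\beta_jM_{ij}=\sum_{i,j\in I}\alpha_i\beta_jM_{ji}$; (ii) $\displaystyle\int_B\frac{D_0(x_0)D_1}{D_0(x_0)+D_1}\Big|\nabla\sum_{i\in I}\alpha_ix^i\Big|^2dx\ \le\ \sum_{i,j\in I}\alpha_i\alpha_jM_{ij}\ \le\ \int_B D_1\Big|\nabla\sum_{i\in I}\alpha_ix^i\Big|^2dx .$ -/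

import Mathlib

open MeasureTheory Filter Topology
open scoped ContDiff Gradient

namespace Inclusion

/-- The monomial `x^i = x_1^{i_1} ⋯ x_d^{i_d}` on `ℝ^d`, for a multi-index `i ∈ ℕ^d`. -/
def monom {d : ℕ} (i : Fin d → ℕ) (x : EuclideanSpace ℝ (Fin d)) : ℝ :=
  ∏ k, x k ^ i k

/-- Test functions: `C_c^∞(ℝ^d)`. -/
def IsTestFunction {d : ℕ} (v : EuclideanSpace ℝ (Fin d) → ℝ) : Prop :=
  ContDiff ℝ ∞ v ∧ HasCompactSupport v

/-- `u ∈ H^1_loc(ℝ^d)`, and the vector field `G ∈ L^2_loc(ℝ^d)^d` is its weak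
(distributional) gradient. -/
structure HasWeakGradient {d : ℕ} (u : EuclideanSpace ℝ (Fin d) → ℝ)
    (G : EuclideanSpace ℝ (Fin d) → EuclideanSpace ℝ (Fin d)) : Prop where
  memLp_fun : ∀ K : Set (EuclideanSpace ℝ (Fin d)), IsCompact K →
    MemLp u 2 (volume.restrict K)
  memLp_grad : ∀ K : Set (EuclideanSpace ℝ (Fin d)), IsCompact K →
    MemLp G 2 (volume.restrict K)
  integral_eq : ∀ v : EuclideanSpace ℝ (Fin d) → ℝ, IsTestFunction v →
    ∫ x, u x • ∇ v x = - ∫ x, v x • G x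

/-- `φ` (with weak gradient `G`) is the corrector of index `j` for the inclusion `B`, the
background value `a₀` and the perturbation `D₁`:
`φ ∈ H^1_loc(ℝ^d) ∩ C^∞(ℝ^d \ closure B)`, `φ(x) = O(|x|^{1-d})` at infinity, and
`∇ · (a₀ + D₁) ∇φ = - ∇ · (1_B D₁ ∇x^j)` in the sense of distributions on `ℝ^d`.
The distributional equation on the whole space contains the harmonicity of `φ` outside
`closure B`, the equation inside `B`, and the jump condition of the conormal derivative
across `∂B`. -/
structure IsCorrector {d : ℕ} (B : Set (EuclideanSpace ℝ (Fin d))) (a₀ : ℝ)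
    (D₁ : EuclideanSpace ℝ (Fin d) → ℝ) (j : Fin d → ℕ)
    (φ : EuclideanSpace ℝ (Fin d) → ℝ)
    (G : EuclideanSpace ℝ (Fin d) → EuclideanSpace ℝ (Fin d)) : Prop where
  weakGradient : HasWeakGradient φ G
  smooth_outside : ContDiffOn ℝ ∞ φ (closure B)ᶜ
  decay : φ =O[cocompact (EuclideanSpace ℝ (Fin d))] fun x => ‖x‖ ^ (1 - (d : ℤ))
  equation : ∀ v : EuclideanSpace ℝ (Fin d) → ℝ, IsTestFunction v →
    ∫ x, (a₀ + D₁ x) * inner ℝ (G x) (∇ v x)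
      = - ∫ x in B, D₁ x * inner ℝ (∇ (monom j) x) (∇ v x)

/-- The generalized polarization tensor
`M_{ij} = ∫_B D₁ ∇(x^j + φ_j) · ∇x^i dx`, where `G j` is the weak gradient of `φ_j`. -/
noncomputable def polarizationTensor {d : ℕ} (B : Set (EuclideanSpace ℝ (Fin d)))
    (D₁ : EuclideanSpace ℝ (Fin d) → ℝ)
    (G : (Fin d → ℕ) → EuclideanSpace ℝ (Fin d) → EuclideanSpace ℝ (Fin d))
    (i j : Fin d → ℕ) : ℝ :=
  ∫ x in B, D₁ x * inner ℝ (∇ (monom j) x + G j x) (∇ (monom i) x)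

end Inclusion

/-! Write `a₀ = D₀ x₀`, `A = a₀ + D₁`, and let `U` and `Γ` be the combinations with coefficients `α`
of the gradients of the monomials and of the correctors. Everything rests on one energy identity:
testing the equation of `φ_i` with `φ_j` gives `∫ A ∇φ_i·∇φ_j + ∫_B D₁ ∇x^i·∇φ_j = 0`
(`IsCorrector.energy`). Hence `M_ij = ∫_B D₁ ∇x^i·∇x^j - ∫ A ∇φ_i·∇φ_j`, which is visibly symmetric.
On the diagonal, dropping `-∫ A |Γ|²` gives the upper bound. Using the identity twice turns the form
into `∫_B D₁|U|² + 2 ∫_B D₁ U·Γ + ∫ A|Γ|²`; discarding the energy outside `B` and completing the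
square pointwise (`completed_square_bound`) gives the lower bound.

Correctors are not test functions, so the identity has to be earned. Coercivity of `A` comes from
blowing up at `x₀` (`ae_le_add_of_forall_scale`). Mollification extends the equation to compactly
supported `H¹` functions (`HasWeakGradient.integral_inner_eq_zero`). Since `φ = O(|x|^{1-d})` and
the cutoffs have gradient `O(|x|⁻¹)`, the products `φ ∇χ_n` have a common majorant of order
`|x|^{-d}`, which is in `L²`. This yields `∇φ ∈ L²` by Caccioppoli
(`HasWeakGradient.memLp_two_grad`) and then removes the cutoff by dominated convergence
(`HasWeakGradient.integral_inner_decaying_eq_zero`). -/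

/-! ### Translations and mollification in `L²` -/

section Mollification

variable {E : Type*} [NormedAddCommGroup E] [InnerProductSpace ℝ E] [FiniteDimensional ℝ E]
  [MeasurableSpace E] [BorelSpace E]

/-- Translation acts continuously on `L²`, and the integral is an `L²` inner product with a
translate. -/
theorem continuous_integral_inner_translate {H W : E → E} (hH : MemLp H 2) (hW : MemLp W 2) :
    Continuous fun t : E => ∫ x, inner ℝ (H x) (W (x - t)) := by
  have : Fact ((2 : ENNReal) ≠ ⊤) := ⟨by norm_num⟩
  have hc : Continuous fun t : E =>
      inner ℝ (hH.toLp H) (DomAddAct.mk (-t) +ᵥ hW.toLp W : Lp E 2 (volume : Measure E)) := by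
    have : Continuous fun t : E =>
        (DomAddAct.mk (-t) +ᵥ hW.toLp W : Lp E 2 (volume : Measure E)) :=
      (DomAddAct.continuous_mk.comp continuous_neg).vadd continuous_const
    fun_prop
  convert hc using 2 with t
  rw [L2.inner_def, DomAddAct.mk_vadd_toLp]
  refine integral_congr_ae ?_
  filter_upwards [hH.coeFn_toLp, MemLp.coeFn_toLp (μ := volume) (p := 2)
    (f := fun x => W (-t +ᵥ x)) (hW.comp_measurePreserving (measurePreserving_vadd (-t) volume))]
    with x h1 h2
  rw [h1, h2, vadd_eq_add, neg_add_eq_sub]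

theorem integral_inner_smul_translate {H W : E → E} (hH : MemLp H 2) (hW : MemLp W 2)
    {ρ : E → ℝ} (hρ : Continuous ρ) (hρc : HasCompactSupport ρ) :
    ∫ x, inner ℝ (H x) (∫ t, ρ t • W (x - t)) = ∫ t, ρ t * ∫ x, inner ℝ (H x) (W (x - t)) := by
  have hρi : Integrable ρ := hρ.integrable_of_hasCompactSupport hρc
  have hH2 := (memLp_two_iff_integrable_sq_norm hH.1).1 hH
  have hW2 := (memLp_two_iff_integrable_sq_norm hW.1).1 hW
  have hprod : Integrable (Function.uncurry fun x t => inner ℝ (H x) (ρ t • W (x - t)))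
      ((volume : Measure E).prod volume) := by
    -- Fubini majorant: `|ρ| (|H|² + |W|²)`, the first term a product and the second a convolution
    -- integrand.
    have h1 : Integrable (fun p : E × E => ‖H p.1‖ ^ 2 * ‖ρ p.2‖)
        ((volume : Measure E).prod volume) := hH2.mul_prod hρi.norm
    have h2 := hρi.norm.convolution_integrand (ContinuousLinearMap.lsmul ℝ ℝ) hW2
    refine (h1.add h2).mono' ?_ ?_
    · have h3 := hρi.1.convolution_integrand (ContinuousLinearMap.lsmul ℝ ℝ) hW.1
      exact (hH.1.comp_fst).inner h3
    · refine Eventually.of_forall fun p => ?_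
      simp only [Function.uncurry, Pi.add_apply, ContinuousLinearMap.lsmul_apply, smul_eq_mul]
      have h4 := norm_inner_le_norm (𝕜 := ℝ) (H p.1) (ρ p.2 • W (p.1 - p.2))
      rw [norm_smul] at h4
      nlinarith [norm_nonneg (ρ p.2), sq_nonneg (‖H p.1‖ - ‖W (p.1 - p.2)‖),
        mul_nonneg (norm_nonneg (ρ p.2)) (sq_nonneg (‖H p.1‖ - ‖W (p.1 - p.2)‖)),
        mul_nonneg (norm_nonneg (ρ p.2)) (sq_nonneg (‖H p.1‖)),
        mul_nonneg (norm_nonneg (ρ p.2)) (sq_nonneg (‖W (p.1 - p.2)‖))]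
  have hWl : LocallyIntegrable W := hW.locallyIntegrable (by norm_num)
  calc _ = ∫ x, ∫ t, inner ℝ (H x) (ρ t • W (x - t)) := by
        congr 1 with x
        rw [integral_inner]
        exact hρc.convolutionExists_left (ContinuousLinearMap.lsmul ℝ ℝ) hρ hWl x
    _ = ∫ t, ∫ x, inner ℝ (H x) (ρ t • W (x - t)) := integral_integral_swap hprod
    _ = _ := by
        congr 1 with t
        simp_rw [inner_smul_right]
        rw [integral_const_mul]

end Mollification

/-! ### Test functions, weak gradients and their approximation -/

namespace Inclusion

variable {d : ℕ}

theorem IsTestFunction.continuous_gradient {v : EuclideanSpace ℝ (Fin d) → ℝ}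
    (hv : IsTestFunction v) : Continuous (∇ v) :=
  (InnerProductSpace.toDual ℝ _).symm.continuous.comp (hv.1.continuous_fderiv (by simp))

theorem IsTestFunction.differentiable {v : EuclideanSpace ℝ (Fin d) → ℝ}
    (hv : IsTestFunction v) : Differentiable ℝ v := hv.1.differentiable (by simp)

theorem tsupport_gradient_subset (v : EuclideanSpace ℝ (Fin d) → ℝ) :
    tsupport (∇ v) ⊆ tsupport v := by
  refine closure_minimal (fun x hx => ?_) (isClosed_tsupport v)
  refine support_fderiv_subset ℝ (f := v) fun h => hx ?_
  simp [gradient, h]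

theorem IsTestFunction.hasCompactSupport_gradient {v : EuclideanSpace ℝ (Fin d) → ℝ}
    (hv : IsTestFunction v) : HasCompactSupport (∇ v) :=
  hv.2.of_isClosed_subset (isClosed_tsupport _) (tsupport_gradient_subset v)

theorem IsTestFunction.mul {v w : EuclideanSpace ℝ (Fin d) → ℝ}
    (hv : IsTestFunction v) (hw : IsTestFunction w) : IsTestFunction fun x => v x * w x :=
  ⟨hv.1.mul hw.1, hv.2.mul_right⟩

theorem gradient_mul_apply {v w : EuclideanSpace ℝ (Fin d) → ℝ} {x : EuclideanSpace ℝ (Fin d)}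
    (hv : DifferentiableAt ℝ v x) (hw : DifferentiableAt ℝ w x) :
    ∇ (fun y => v y * w y) x = v x • ∇ w x + w x • ∇ v x := by
  simp only [gradient]
  rw [fderiv_fun_mul hv hw]
  simp

/-- A continuous compactly supported multiple of a locally `L²` function is in `L²`. -/
theorem memLp_smul_of_hasCompactSupport {F : Type*} [NormedAddCommGroup F] [NormedSpace ℝ F]
    {f : EuclideanSpace ℝ (Fin d) → ℝ} {g : EuclideanSpace ℝ (Fin d) → F}
    (hf : Continuous f) (hfc : HasCompactSupport f)
    (hg : ∀ K : Set (EuclideanSpace ℝ (Fin d)), IsCompact K → MemLp g 2 (volume.restrict K)) :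
    MemLp (fun x => f x • g x) 2 := by
  obtain ⟨C, hC⟩ := hf.bounded_above_of_compact_support hfc
  have h : MemLp (fun x => f x • g x) 2 (volume.restrict (tsupport f)) := by
    refine (hg _ hfc).of_le_mul (hf.aestronglyMeasurable.smul (hg _ hfc).1)
      (c := C) (Eventually.of_forall fun x => ?_)
    rw [norm_smul]
    exact mul_le_mul_of_nonneg_right (hC x) (norm_nonneg _)
  rw [← memLp_indicator_iff_restrict (isClosed_tsupport f).measurableSet] at h
  refine (congrArg (MemLp · 2 volume) (funext fun x => ?_)).mp h
  by_cases hx : x ∈ tsupport f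
  · simp [hx]
  · simp [hx, image_eq_zero_of_notMem_tsupport hx]

theorem memLp_smul_of_hasCompactSupport' {F : Type*} [NormedAddCommGroup F] [NormedSpace ℝ F]
    {f : EuclideanSpace ℝ (Fin d) → F} {g : EuclideanSpace ℝ (Fin d) → ℝ}
    (hf : Continuous f) (hfc : HasCompactSupport f)
    (hg : ∀ K : Set (EuclideanSpace ℝ (Fin d)), IsCompact K → MemLp g 2 (volume.restrict K)) :
    MemLp (fun x => g x • f x) 2 := by
  obtain ⟨C, hC⟩ := hf.bounded_above_of_compact_support hfc
  have h : MemLp (fun x => g x • f x) 2 (volume.restrict (tsupport f)) := by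
    refine (hg _ hfc).of_le_mul ((hg _ hfc).1.smul hf.aestronglyMeasurable)
      (c := C) (Eventually.of_forall fun x => ?_)
    rw [norm_smul, mul_comm]
    exact mul_le_mul_of_nonneg_right (hC x) (norm_nonneg _)
  rw [← memLp_indicator_iff_restrict (isClosed_tsupport f).measurableSet] at h
  refine (congrArg (MemLp · 2 volume) (funext fun x => ?_)).mp h
  by_cases hx : x ∈ tsupport f
  · simp [hx]
  · simp [hx, image_eq_zero_of_notMem_tsupport hx]

theorem integrable_inner_of_memLp {H W : EuclideanSpace ℝ (Fin d) → EuclideanSpace ℝ (Fin d)}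
    {μ : Measure (EuclideanSpace ℝ (Fin d))} (hH : MemLp H 2 μ) (hW : MemLp W 2 μ) :
    Integrable (fun x => inner ℝ (H x) (W x)) μ := by
  refine (hH.norm.integrable_mul hW.norm).mono' (hH.1.inner hW.1) (Eventually.of_forall fun x => ?_)
  exact norm_inner_le_norm _ _

theorem locallyIntegrable_of_memLp {F : Type*} [NormedAddCommGroup F]
    {f : EuclideanSpace ℝ (Fin d) → F}
    (hf : ∀ K : Set (EuclideanSpace ℝ (Fin d)), IsCompact K → MemLp f 2 (volume.restrict K)) :
    LocallyIntegrable f := by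
  rw [locallyIntegrable_iff]
  intro K hK
  have : IsFiniteMeasure (volume.restrict K) := ⟨by simpa using hK.measure_lt_top⟩
  exact (hf K hK).integrable (by norm_num)

/-- Multiplying by a test function preserves weak differentiability (product rule). -/
theorem HasWeakGradient.smul_testFunction {u η : EuclideanSpace ℝ (Fin d) → ℝ}
    {G : EuclideanSpace ℝ (Fin d) → EuclideanSpace ℝ (Fin d)}
    (hu : HasWeakGradient u G) (hη : IsTestFunction η) :
    HasWeakGradient (fun x => η x * u x) (fun x => η x • G x + u x • ∇ η x) where
  memLp_fun K _ :=
    (memLp_smul_of_hasCompactSupport hη.1.continuous hη.2 hu.memLp_fun).restrict K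
  memLp_grad K _ :=
    ((memLp_smul_of_hasCompactSupport hη.1.continuous hη.2 hu.memLp_grad).add
      (memLp_smul_of_hasCompactSupport' hη.continuous_gradient hη.hasCompactSupport_gradient
        hu.memLp_fun)).restrict K
  integral_eq v hv := by
    -- Testing `u` with `η v` and expanding `∇(η v)` moves the cutoff onto `u`.
    have h := hu.integral_eq _ (hη.mul hv)
    have hul := locallyIntegrable_of_memLp hu.memLp_fun
    have hGl := locallyIntegrable_of_memLp hu.memLp_grad
    have i1 : Integrable fun x => u x • (η x • ∇ v x) :=
      hul.integrable_smul_right_of_hasCompactSupport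
        (hη.1.continuous.smul hv.continuous_gradient)
        (hη.2.smul_right)
    have i2 : Integrable fun x => u x • (v x • ∇ η x) :=
      hul.integrable_smul_right_of_hasCompactSupport
        (hv.1.continuous.smul hη.continuous_gradient)
        (hv.2.smul_right)
    have i3 : Integrable fun x => (η x * v x) • G x :=
      hGl.integrable_smul_left_of_hasCompactSupport
        (hη.mul hv).1.continuous (hη.mul hv).2
    have e1 : ∫ x, u x • ∇ (fun y => η y * v y) x
        = (∫ x, u x • (η x • ∇ v x)) + ∫ x, u x • (v x • ∇ η x) := by
      rw [← integral_add i1 i2]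
      refine integral_congr_ae (Eventually.of_forall fun x => ?_)
      beta_reduce
      rw [gradient_mul_apply (hη.differentiable x) (hv.differentiable x), smul_add]
    have e2 : ∫ x, v x • (η x • G x + u x • ∇ η x)
        = (∫ x, (η x * v x) • G x) + ∫ x, u x • (v x • ∇ η x) := by
      rw [← integral_add i3 i2]
      refine integral_congr_ae (Eventually.of_forall fun x => ?_)
      module
    have e3 : ∫ x, (η x * u x) • ∇ v x = ∫ x, u x • (η x • ∇ v x) := by
      refine integral_congr_ae (Eventually.of_forall fun x => ?_)
      module
    rw [e2, e3, neg_add, ← h, e1]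
    abel

theorem IsTestFunction.comp_sub_left {ρ : EuclideanSpace ℝ (Fin d) → ℝ} (hρ : IsTestFunction ρ)
    (x : EuclideanSpace ℝ (Fin d)) : IsTestFunction fun y => ρ (x - y) :=
  ⟨hρ.1.comp (contDiff_const.sub contDiff_id),
    hρ.2.comp_homeomorph (Homeomorph.subLeft x)⟩

theorem gradient_comp_sub_left {ρ : EuclideanSpace ℝ (Fin d) → ℝ} (hρ : IsTestFunction ρ)
    (x y : EuclideanSpace ℝ (Fin d)) : ∇ (fun y => ρ (x - y)) y = -∇ ρ (x - y) := by
  have h : HasFDerivAt (fun y => ρ (x - y))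
      ((fderiv ℝ ρ (x - y)).comp (-ContinuousLinearMap.id ℝ _)) y :=
    (hρ.differentiable (x - y)).hasFDerivAt.comp y ((hasFDerivAt_id y).const_sub x)
  simp only [gradient, h.fderiv]
  rw [← map_neg]
  congr 1
  ext
  simp

/-- Mollification commutes with the weak gradient. -/
theorem HasWeakGradient.gradient_convolution {u ρ : EuclideanSpace ℝ (Fin d) → ℝ}
    {G : EuclideanSpace ℝ (Fin d) → EuclideanSpace ℝ (Fin d)}
    (hu : HasWeakGradient u G) (hρ : IsTestFunction ρ) (x : EuclideanSpace ℝ (Fin d)) :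
    ∇ (convolution ρ u (ContinuousLinearMap.lsmul ℝ ℝ) volume) x = ∫ t, ρ t • G (x - t) := by
  have hul := locallyIntegrable_of_memLp hu.memLp_fun
  have hGl := locallyIntegrable_of_memLp hu.memLp_grad
  have hfd := hρ.2.hasFDerivAt_convolution_left (ContinuousLinearMap.lsmul ℝ ℝ)
    (hρ.1.of_le (by simp)) hul x
  -- The derivative of the convolution falls on `ρ`; testing with `y ↦ ρ (x - y)` transfers it to
  -- `u`, the reflection cancelling the sign of the weak derivative.
  have hweak := hu.integral_eq _ (hρ.comp_sub_left x)
  have hint : Integrable fun y => u y • ∇ (fun y => ρ (x - y)) y :=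
    hul.integrable_smul_right_of_hasCompactSupport (hρ.comp_sub_left x).continuous_gradient
      (hρ.comp_sub_left x).hasCompactSupport_gradient
  have hfdi : Integrable fun t =>
      (ContinuousLinearMap.precompL (EuclideanSpace ℝ (Fin d)) (ContinuousLinearMap.lsmul ℝ ℝ))
        (fderiv ℝ ρ t) (u (x - t)) :=
    (hρ.2.fderiv ℝ).convolutionExists_left _ (hρ.1.continuous_fderiv (by simp)) hul x
  refine ext_inner_right ℝ fun w => ?_
  rw [inner_gradient_left, hfd.fderiv, convolution_def,
    ContinuousLinearMap.integral_apply hfdi]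
  have e1 : ∫ t, ρ t • G (x - t) = ∫ y, ρ (x - y) • G y := by
    rw [← integral_sub_left_eq_self _ volume x]
    simp
  rw [e1, eq_neg_iff_add_eq_zero.2 (by rw [hweak]; simp :
    (∫ y, ρ (x - y) • G y) + ∫ y, u y • ∇ (fun y => ρ (x - y)) y = 0), inner_neg_left,
    real_inner_comm, ← integral_inner hint, ← integral_neg,
    ← integral_sub_left_eq_self _ volume x]
  refine integral_congr_ae (Eventually.of_forall fun y => ?_)
  beta_reduce
  rw [gradient_comp_sub_left hρ, inner_smul_right, inner_neg_right, real_inner_comm,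
    inner_gradient_left]
  simp [ContinuousLinearMap.precompL_apply, mul_comm]

/-- A locally square integrable field that annihilates the gradients of all test functions
annihilates the weak gradient of every compactly supported `H¹` function. -/
theorem HasWeakGradient.integral_inner_eq_zero {u : EuclideanSpace ℝ (Fin d) → ℝ}
    {G H : EuclideanSpace ℝ (Fin d) → EuclideanSpace ℝ (Fin d)}
    (hu : HasWeakGradient u G) (huc : HasCompactSupport u) (hGc : HasCompactSupport G)
    (hH : ∀ K : Set (EuclideanSpace ℝ (Fin d)), IsCompact K → MemLp H 2 (volume.restrict K))
    (hH0 : ∀ v, IsTestFunction v → ∫ x, inner ℝ (H x) (∇ v x) = 0) :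
    ∫ x, inner ℝ (H x) (G x) = 0 := by
  obtain ⟨R, hR⟩ := (hGc.isCompact.union huc.isCompact).isBounded.subset_closedBall 0
  have hGR : ∀ x, x ∉ Metric.closedBall 0 R → G x = 0 := fun x hx =>
    image_eq_zero_of_notMem_tsupport fun h => hx (hR (Or.inl h))
  have huR : ∀ x, x ∉ Metric.closedBall 0 R → u x = 0 := fun x hx =>
    image_eq_zero_of_notMem_tsupport fun h => hx (hR (Or.inr h))
  -- Truncating `H` to this ball makes it globally `L²`. The margin `1` exceeds or equals every
  -- mollifier radius, so mollifications of `G` still vanish outside it.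
  set B := Metric.closedBall (0 : EuclideanSpace ℝ (Fin d)) (R + 1) with hB
  have hBc : IsCompact B := isCompact_closedBall _ _
  set H' := B.indicator H with hH'
  have hH'2 : MemLp H' 2 := (memLp_indicator_iff_restrict hBc.measurableSet).2 (hH B hBc)
  have hG2 : MemLp G 2 := by
    have := (memLp_indicator_iff_restrict hGc.isCompact.measurableSet).2
      (hu.memLp_grad _ hGc.isCompact)
    rwa [Set.indicator_eq_self.2 (subset_tsupport G)] at this
  have hcont := continuous_integral_inner_translate hH'2 hG2
  let b : ℕ → ContDiffBump (0 : EuclideanSpace ℝ (Fin d)) := fun n =>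
    ⟨1 / (n + 1) / 2, 1 / (n + 1), by positivity, by
      have : (0 : ℝ) < 1 / (n + 1) := by positivity
      linarith⟩
  have hb : Tendsto (fun n => (b n).rOut) atTop (𝓝 0) := tendsto_one_div_add_atTop_nhds_zero_nat
  have hlim := ContDiffBump.convolution_tendsto_right_of_continuous (μ := volume) hb hcont 0
  -- The mollified correlation of `H'` and `G` at `0` is `∫ H'·∇(ρ_n * u)`, with `ρ_n * u` a test
  -- function; letting the mollifier concentrate recovers the correlation itself at `0`.
  have hzero : ∀ n, convolution ((b n).normed volume)
      (fun t => ∫ x, inner ℝ (H' x) (G (x - t))) (ContinuousLinearMap.lsmul ℝ ℝ) volume 0 = 0 := by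
    intro n
    have hρ : IsTestFunction ((b n).normed volume) :=
      ⟨(b n).contDiff_normed, (b n).hasCompactSupport_normed⟩
    have hρ' : IsTestFunction fun t => (b n).normed volume (0 - t) := hρ.comp_sub_left 0
    have e : convolution ((b n).normed volume)
        (fun t => ∫ x, inner ℝ (H' x) (G (x - t))) (ContinuousLinearMap.lsmul ℝ ℝ) volume 0
        = ∫ t, (b n).normed volume t * ∫ x, inner ℝ (H' x) (G (x - t)) := by
      rw [convolution_def, ← integral_neg_eq_self]
      simp [ContDiffBump.normed_neg]
    rw [e, ← integral_inner_smul_translate hH'2 hG2 hρ.1.continuous hρ.2]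
    simp_rw [← hu.gradient_convolution hρ]
    have hul := locallyIntegrable_of_memLp hu.memLp_fun
    set v := convolution ((b n).normed volume) u (ContinuousLinearMap.lsmul ℝ ℝ) volume with hv
    have hvt : IsTestFunction v :=
      ⟨hρ.2.contDiff_convolution_left _ hρ.1 hul, hρ.2.convolution _ huc⟩
    rw [← hH0 v hvt]
    refine integral_congr_ae (Eventually.of_forall fun x => ?_)
    beta_reduce
    by_cases hx : x ∈ B
    · rw [hH', Set.indicator_of_mem hx]
    · have : ∇ v x = 0 := by
        rw [hv, hu.gradient_convolution hρ]
        refine integral_eq_zero_of_ae (Eventually.of_forall fun t => ?_)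
        by_cases ht : t ∈ Metric.ball (0 : EuclideanSpace ℝ (Fin d)) (b n).rOut
        · have hG0 : G (x - t) = 0 := by
            refine hGR _ fun h => hx ?_
            simp only [hB, Metric.mem_closedBall, dist_zero_right, Metric.mem_ball] at h ht ⊢
            have h1 : (b n).rOut ≤ 1 := by
              show 1 / ((n : ℝ) + 1) ≤ 1
              rw [div_le_one (by positivity)]
              linarith [n.cast_nonneg (α := ℝ)]
            have h2 := norm_add_le (x - t) t
            rw [sub_add_cancel] at h2
            linarith
          simp [hG0]
        · have : (b n).normed volume t = 0 := by
            rw [← Function.notMem_support, (b n).support_normed_eq]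
            exact ht
          simp [this]
      simp [this]
  simp_rw [hzero] at hlim
  have h0 := tendsto_nhds_unique hlim tendsto_const_nhds
  simp only [sub_zero] at h0
  rw [← h0]
  refine integral_congr_ae (Eventually.of_forall fun x => ?_)
  beta_reduce
  by_cases hx : x ∈ B
  · rw [hH', Set.indicator_of_mem hx]
  · have : G x = 0 := hGR x fun h => hx (Metric.closedBall_subset_closedBall (by linarith) h)
    simp [this]

/-! ### Cutoffs at infinity and the decay of correctors -/

/-- A sequence of smooth cutoffs `χ n` equal to `1` on the ball of radius `n + 1`, with
gradients of size `O((1 + ‖x‖)⁻¹)` uniformly in `n`. -/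
theorem exists_cutoff (d : ℕ) : ∃ (χ : ℕ → EuclideanSpace ℝ (Fin d) → ℝ) (C : ℝ), 0 ≤ C ∧
    (∀ n, IsTestFunction (χ n)) ∧ (∀ n x, 0 ≤ χ n x) ∧ (∀ n x, χ n x ≤ 1) ∧
    (∀ (n : ℕ) x, ‖x‖ < n + 1 → χ n x = 1) ∧ (∀ (n : ℕ) x, ‖x‖ < n + 1 → ∇ (χ n) x = 0) ∧
    ∀ n x, ‖∇ (χ n) x‖ ≤ C / (1 + ‖x‖) := by
  let b : ContDiffBump (0 : EuclideanSpace ℝ (Fin d)) := ⟨1, 2, one_pos, one_lt_two⟩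
  have hbt : IsTestFunction (b : EuclideanSpace ℝ (Fin d) → ℝ) :=
    ⟨b.contDiff, b.hasCompactSupport⟩
  obtain ⟨C, hC⟩ :=
    hbt.continuous_gradient.bounded_above_of_compact_support hbt.hasCompactSupport_gradient
  have hC0 : 0 ≤ C := (norm_nonneg _).trans (hC 0)
  have hpos (n : ℕ) : (0 : ℝ) < n + 1 := by positivity
  have hnorm (n : ℕ) (x : EuclideanSpace ℝ (Fin d)) :
      ‖((n : ℝ) + 1)⁻¹ • x‖ = ‖x‖ / (n + 1) := by
    rw [norm_smul, Real.norm_of_nonneg (inv_nonneg.2 (hpos n).le)]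
    field_simp
  have hgrad (n : ℕ) (x : EuclideanSpace ℝ (Fin d)) :
      ∇ (fun x => b (((n : ℝ) + 1)⁻¹ • x)) x
        = ((n : ℝ) + 1)⁻¹ • ∇ (b : EuclideanSpace ℝ (Fin d) → ℝ) (((n : ℝ) + 1)⁻¹ • x) := by
    have h : HasFDerivAt (fun x => b (((n : ℝ) + 1)⁻¹ • x))
        ((fderiv ℝ b (((n : ℝ) + 1)⁻¹ • x)).comp
          (((n : ℝ) + 1)⁻¹ • ContinuousLinearMap.id ℝ _)) x :=
      (hbt.differentiable _).hasFDerivAt.comp x ((hasFDerivAt_id (𝕜 := ℝ) x).const_smul (((n : ℝ) + 1)⁻¹))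
    simp only [gradient, h.fderiv]
    rw [← map_smul]
    congr 1
    ext
    simp
  have hone (n : ℕ) (x : EuclideanSpace ℝ (Fin d)) (hx : ‖x‖ < n + 1) :
      b (((n : ℝ) + 1)⁻¹ • x) = 1 := by
    refine b.one_of_mem_closedBall ?_
    rw [mem_closedBall_zero_iff, hnorm]
    exact (div_le_one (hpos n)).2 hx.le
  -- The factor `3`: where the gradient is nonzero, `‖x‖ ≤ 2 (n + 1)`, so `1 + ‖x‖ ≤ 3 (n + 1)`.
  refine ⟨fun n x => b (((n : ℝ) + 1)⁻¹ • x), 3 * C, by positivity, fun n => ⟨?_, ?_⟩,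
    fun n x => b.nonneg, fun n x => b.le_one, hone, fun n x hx => ?_, fun n x => ?_⟩
  · exact b.contDiff.comp (contDiff_const_smul _)
  · exact b.hasCompactSupport.comp_homeomorph
      (Homeomorph.smulOfNeZero ((n : ℝ) + 1)⁻¹ (inv_ne_zero (hpos n).ne'))
  · have : (fun x => b (((n : ℝ) + 1)⁻¹ • x)) =ᶠ[𝓝 x] fun _ => 1 := by
      filter_upwards [(isOpen_lt continuous_norm continuous_const).mem_nhds hx] with y hy
      exact hone n y hy
    rw [this.gradient_eq, gradient_fun_const]
  · rw [hgrad, norm_smul, Real.norm_of_nonneg (inv_nonneg.2 (hpos n).le)]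
    by_cases hx : ‖x‖ ≤ 2 * (n + 1)
    · rw [inv_mul_eq_div, div_le_div_iff₀ (hpos n) (by positivity)]
      have h1 : 1 + ‖x‖ ≤ 3 * (n + 1) := by linarith [n.cast_nonneg (α := ℝ)]
      calc _ ≤ C * (3 * (n + 1)) := mul_le_mul (hC _) h1 (by positivity) hC0
        _ = _ := by ring
    · have : ∇ (b : EuclideanSpace ℝ (Fin d) → ℝ) (((n : ℝ) + 1)⁻¹ • x) = 0 := by
        refine image_eq_zero_of_notMem_tsupport fun h => hx ?_
        have h2 := tsupport_gradient_subset _ h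
        rw [b.tsupport_eq, mem_closedBall_zero_iff, hnorm, div_le_iff₀ (hpos n)] at h2
        exact h2
      rw [this, norm_zero, mul_zero]
      positivity

theorem memLp_inv_one_add_norm_pow (hd : 0 < d) :
    MemLp (fun x : EuclideanSpace ℝ (Fin d) => ((1 + ‖x‖) ^ d)⁻¹) 2 := by
  have hc : Continuous fun x : EuclideanSpace ℝ (Fin d) => ((1 + ‖x‖) ^ d)⁻¹ := by
    refine Continuous.inv₀ (by fun_prop) fun x => by positivity
  rw [memLp_two_iff_integrable_sq_norm hc.aestronglyMeasurable]
  have h := integrable_one_add_norm (E := EuclideanSpace ℝ (Fin d)) (μ := volume)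
    (r := ((2 * d : ℕ) : ℝ)) (by
      rw [finrank_euclideanSpace_fin]
      exact_mod_cast (by omega : d < 2 * d))
  refine h.congr (Eventually.of_forall fun x => ?_)
  beta_reduce
  rw [Real.norm_of_nonneg (by positivity), Real.rpow_neg (by positivity), Real.rpow_natCast,
    inv_pow, ← pow_mul, mul_comm d]

/-- The orders `1 - d` and `-1` add up to `-d`, with a majorant independent of `n`. The threshold
`N` places the region where `∇ (χ n)` lives inside the region where the decay bound holds. -/
theorem exists_bound_smul_gradient_cutoff (hd : 0 < d) {φ : EuclideanSpace ℝ (Fin d) → ℝ}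
    (hφ : φ =O[cocompact (EuclideanSpace ℝ (Fin d))] fun x => ‖x‖ ^ (1 - (d : ℤ)))
    {χ : ℕ → EuclideanSpace ℝ (Fin d) → ℝ} {C : ℝ} (hC : 0 ≤ C)
    (hχ0 : ∀ (n : ℕ) x, ‖x‖ < n + 1 → ∇ (χ n) x = 0) (hχ : ∀ n x, ‖∇ (χ n) x‖ ≤ C / (1 + ‖x‖)) :
    ∃ C', ∃ N : ℕ, ∀ n ≥ N, ∀ x, ‖φ x • ∇ (χ n) x‖ ≤ C' * ((1 + ‖x‖) ^ d)⁻¹ := by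
  obtain ⟨k, hk, hφk⟩ := hφ.exists_nonneg
  have hev := hφk.bound
  rw [← Metric.cobounded_eq_cocompact, ← comap_norm_atTop, eventually_comap,
    eventually_atTop] at hev
  obtain ⟨R, hR⟩ := hev
  obtain ⟨N, hN⟩ := exists_nat_ge R
  refine ⟨k * 2 ^ (d - 1) * C, N, fun n hn x => ?_⟩
  by_cases hx : ‖x‖ < n + 1
  · rw [hχ0 n x hx]
    simp only [smul_zero, norm_zero]
    positivity
  · have hx1 : (n : ℝ) + 1 ≤ ‖x‖ := not_lt.1 hx
    have hn' : (N : ℝ) ≤ n := by exact_mod_cast hn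
    have hxone : 1 ≤ ‖x‖ := by linarith [n.cast_nonneg (α := ℝ)]
    have h1 := hR ‖x‖ (by linarith) x rfl
    obtain ⟨m, rfl⟩ : ∃ m, d = m + 1 := ⟨d - 1, by omega⟩
    have h2 : ‖‖x‖ ^ (1 - ((m + 1 : ℕ) : ℤ))‖ = (‖x‖ ^ m)⁻¹ := by
      rw [show (1 - ((m + 1 : ℕ) : ℤ)) = -(m : ℤ) by push_cast; ring, zpow_neg, zpow_natCast,
        Real.norm_of_nonneg (by positivity)]
    rw [h2] at h1
    -- From `1 ≤ ‖x‖` one has `1 + ‖x‖ ≤ 2 ‖x‖`, whence the factor `2 ^ (d - 1)`.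
    have h3 : (‖x‖ ^ m)⁻¹ ≤ 2 ^ m * ((1 + ‖x‖) ^ m)⁻¹ := by
      rw [← div_eq_mul_inv, inv_eq_one_div, div_le_div_iff₀ (by positivity) (by positivity),
        one_mul, ← mul_pow]
      exact pow_le_pow_left₀ (by positivity) (by linarith) _
    rw [norm_smul]
    calc ‖φ x‖ * ‖∇ (χ n) x‖ ≤ (k * (2 ^ m * ((1 + ‖x‖) ^ m)⁻¹)) * (C / (1 + ‖x‖)) :=
          mul_le_mul (h1.trans (mul_le_mul_of_nonneg_left h3 hk)) (hχ n x) (norm_nonneg _)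
            (by positivity)
      _ = _ := by
          simp only [Nat.add_sub_cancel]
          field_simp
          ring

end Inclusion

/-! ### Caccioppoli estimate and energy identity -/

namespace Inclusion

variable {d : ℕ} {A : EuclideanSpace ℝ (Fin d) → ℝ} {c M : ℝ}
  {F G G' : EuclideanSpace ℝ (Fin d) → EuclideanSpace ℝ (Fin d)}
  {φ φ' Ψ : EuclideanSpace ℝ (Fin d) → ℝ} {χ : ℕ → EuclideanSpace ℝ (Fin d) → ℝ}

theorem memLp_two_coeff_smul {μ : Measure (EuclideanSpace ℝ (Fin d))}
    (hA : AEStronglyMeasurable A μ) (hM : ∀ᵐ x ∂μ, ‖A x‖ ≤ M) (hG : MemLp G 2 μ) :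
    MemLp (fun x => A x • G x) 2 μ := by
  refine hG.of_le_mul (hA.smul hG.1) (c := M) ?_
  filter_upwards [hM] with x hx
  rw [norm_smul]
  exact mul_le_mul_of_nonneg_right hx (norm_nonneg _)

theorem integrable_inner_of_hasCompactSupport
    (hF : ∀ K : Set (EuclideanSpace ℝ (Fin d)), IsCompact K → MemLp F 2 (volume.restrict K))
    (hG : ∀ K : Set (EuclideanSpace ℝ (Fin d)), IsCompact K → MemLp G 2 (volume.restrict K))
    (hGc : HasCompactSupport G) : Integrable (fun x => inner ℝ (F x) (G x)) := by
  have h := integrable_inner_of_memLp (hF _ hGc) (hG _ hGc)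
  refine (integrableOn_iff_integrable_of_support_subset (s := tsupport G) fun x hx =>
    subset_tsupport G ?_).1 h
  intro h0
  exact hx (by simp only [h0, inner_zero_right])

/-- The weak equation `∇ · (A G + F) = 0` may be tested with `η φ'`, for `φ' ∈ H¹_loc`. -/
theorem HasWeakGradient.integral_inner_smul_add_eq_zero
    (hA : AEStronglyMeasurable A) (hM : ∀ᵐ x, ‖A x‖ ≤ M) (hF : MemLp F 2)
    (hG : HasWeakGradient φ G) (hG' : HasWeakGradient φ' G')
    (heq : ∀ v, IsTestFunction v → ∫ x, inner ℝ (A x • G x + F x) (∇ v x) = 0)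
    {η : EuclideanSpace ℝ (Fin d) → ℝ} (hη : IsTestFunction η) :
    Integrable (fun x => inner ℝ (A x • G x + F x) (η x • G' x + φ' x • ∇ η x)) ∧
    ∫ x, inner ℝ (A x • G x + F x) (η x • G' x + φ' x • ∇ η x) = 0 := by
  have hH (K : Set (EuclideanSpace ℝ (Fin d))) (hK : IsCompact K) :
      MemLp (fun x => A x • G x + F x) 2 (volume.restrict K) :=
    (memLp_two_coeff_smul hA.restrict (ae_restrict_of_ae hM) (hG.memLp_grad K hK)).add
      (hF.restrict K)
  have hw := hG'.smul_testFunction hη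
  have hc : HasCompactSupport fun x => η x • G' x + φ' x • ∇ η x := by
    refine HasCompactSupport.intro hη.2 fun x hx => ?_
    rw [image_eq_zero_of_notMem_tsupport hx,
      image_eq_zero_of_notMem_tsupport fun h => hx (tsupport_gradient_subset η h)]
    simp
  have hu : HasCompactSupport fun x => η x * φ' x := hη.2.mul_right
  exact ⟨integrable_inner_of_hasCompactSupport hH hw.memLp_grad hc,
    hw.integral_inner_eq_zero hu hc hH heq⟩

/-- Pointwise form of Caccioppoli, for `t = χ`, `g = ∇φ`, `p = φ ∇χ` and source `f`; the second
vector is then the gradient of `χ² φ`. -/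
theorem inner_cutoff_lower_bound {V : Type*} [NormedAddCommGroup V] [InnerProductSpace ℝ V]
    {a t : ℝ} (hc : 0 < c) (hca : c ≤ a) (haM : a ≤ M) (g f p : V) :
    c / 4 * (t ^ 2 * ‖g‖ ^ 2) - (2 * M + 1) * ‖p‖ ^ 2 - (1 + c⁻¹) * (t ^ 2 * ‖f‖ ^ 2)
      ≤ inner ℝ (a • g + f) (t ^ 2 • g + (2 * t) • p) := by
  have e1 : inner ℝ (a • g + f) (t ^ 2 • g + (2 * t) • p)
      = a * ‖t • g‖ ^ 2 + 2 * a * inner ℝ (t • g) p + inner ℝ (t • f) (t • g)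
        + 2 * inner ℝ (t • f) p := by
    simp only [inner_add_left, inner_add_right, real_inner_smul_left, real_inner_smul_right,
      norm_smul, mul_pow, real_inner_self_eq_norm_sq, Real.norm_eq_abs, sq_abs]
    ring
  have e2 : ∀ v : V, t ^ 2 * ‖v‖ ^ 2 = ‖t • v‖ ^ 2 := fun v => by
    rw [norm_smul, mul_pow, Real.norm_eq_abs, sq_abs]
  rw [e1, e2, e2]
  have ha : 0 < a := hc.trans_le hca
  -- Three Young inequalities: `a / 2` of the good term absorbs the cross term with `p`, `c / 4`
  -- absorbs the source, and at least `c / 4` survives.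
  have h1 : 0 ≤ a / 2 * ‖t • g‖ ^ 2 + 2 * a * inner ℝ (t • g) p + 2 * a * ‖p‖ ^ 2 := by
    have := norm_add_sq_real (t • g) ((2 : ℝ) • p)
    rw [real_inner_smul_right, norm_smul (2 : ℝ), Real.norm_of_nonneg zero_le_two] at this
    have h0 := mul_nonneg ha.le (sq_nonneg ‖t • g + (2 : ℝ) • p‖)
    rw [this] at h0
    linarith
  have h2 : 0 ≤ c / 4 * ‖t • g‖ ^ 2 + inner ℝ (t • f) (t • g) + c⁻¹ * ‖t • f‖ ^ 2 := by
    have := norm_add_sq_real (t • f) ((c / 2) • (t • g))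
    rw [real_inner_smul_right, norm_smul (c / 2), Real.norm_of_nonneg (by positivity)] at this
    have h0 := mul_nonneg (inv_nonneg.2 hc.le) (sq_nonneg ‖t • f + (c / 2) • (t • g)‖)
    rw [this] at h0
    field_simp at h0 ⊢
    nlinarith
  have h3 : 0 ≤ ‖t • f‖ ^ 2 + 2 * inner ℝ (t • f) p + ‖p‖ ^ 2 := by
    rw [← norm_add_sq_real]
    positivity
  have h4 : c * ‖t • g‖ ^ 2 ≤ a * ‖t • g‖ ^ 2 := mul_le_mul_of_nonneg_right hca (sq_nonneg _)
  have h5 : a * ‖p‖ ^ 2 ≤ M * ‖p‖ ^ 2 := mul_le_mul_of_nonneg_right haM (sq_nonneg _)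
  linarith

/-- Caccioppoli: a decaying solution has globally square integrable gradient. -/
theorem HasWeakGradient.memLp_two_grad (hc : 0 < c)
    (hA : AEStronglyMeasurable A) (hcA : ∀ᵐ x, c ≤ A x) (hM : ∀ᵐ x, A x ≤ M) (hF : MemLp F 2)
    (hG : HasWeakGradient φ G)
    (heq : ∀ v, IsTestFunction v → ∫ x, inner ℝ (A x • G x + F x) (∇ v x) = 0)
    (hχ : ∀ n, IsTestFunction (χ n)) (hχ0 : ∀ n x, 0 ≤ χ n x) (hχ1 : ∀ n x, χ n x ≤ 1)
    (hχn : ∀ (n : ℕ) x, ‖x‖ < n + 1 → χ n x = 1) (hΨ : MemLp Ψ 2)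
    {N : ℕ} (hφΨ : ∀ n ≥ N, ∀ x, ‖φ x • ∇ (χ n) x‖ ≤ Ψ x) :
    MemLp G 2 := by
  have hMabs : ∀ᵐ x, ‖A x‖ ≤ M := by
    filter_upwards [hcA, hM] with x h1 h2
    rwa [Real.norm_of_nonneg (hc.le.trans h1)]
  have hGm : AEStronglyMeasurable G :=
    (locallyIntegrable_of_memLp hG.memLp_grad).aestronglyMeasurable
  rw [memLp_two_iff_integrable_sq_norm hGm]
  have hM0 : 0 ≤ M := by
    obtain ⟨x, h1, h2⟩ := (hcA.and hM).exists
    linarith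
  have hF2 := (memLp_two_iff_integrable_sq_norm hF.1).1 hF
  have hΨ2 := (memLp_two_iff_integrable_sq_norm hΨ.1).1 hΨ
  have hcover : AECover (volume : Measure (EuclideanSpace ℝ (Fin d))) atTop
      fun n : ℕ => Metric.ball 0 ((n : ℝ) + 1) :=
    aecover_ball (tendsto_atTop_add_const_right _ _ tendsto_natCast_atTop_atTop)
  set K := ∫ x, ((2 * M + 1) * ‖Ψ x‖ ^ 2 + (1 + c⁻¹) * ‖F x‖ ^ 2) with hK
  have hKi : Integrable fun x => (2 * M + 1) * ‖Ψ x‖ ^ 2 + (1 + c⁻¹) * ‖F x‖ ^ 2 :=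
    (hΨ2.const_mul _).add (hF2.const_mul _)
  refine hcover.integrable_of_integral_bounded_of_nonneg_ae (4 / c * K) (fun n => ?_)
    (Eventually.of_forall fun x => sq_nonneg _) ?_
  · have h := hG.memLp_grad _ (isCompact_closedBall 0 ((n : ℝ) + 1))
    rw [memLp_two_iff_integrable_sq_norm h.1] at h
    exact IntegrableOn.mono_set h Metric.ball_subset_closedBall
  filter_upwards [eventually_ge_atTop N] with n hn
  -- The cutoff is squared so that the cross term carries `χ n • G` and can be absorbed by `χ n ^ 2
  -- * ‖G‖ ^ 2`.
  have hχ2 : IsTestFunction fun x => χ n x * χ n x := (hχ n).mul (hχ n)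
  obtain ⟨hi, h0⟩ := hG.integral_inner_smul_add_eq_zero hA hMabs hF hG heq hχ2
  have hχG : Integrable fun x => (χ n x) ^ 2 * ‖G x‖ ^ 2 := by
    have h := memLp_smul_of_hasCompactSupport (hχ n).1.continuous (hχ n).2 hG.memLp_grad
    rw [memLp_two_iff_integrable_sq_norm h.1] at h
    refine h.congr (Eventually.of_forall fun x => ?_)
    beta_reduce
    rw [norm_smul, mul_pow, Real.norm_eq_abs, sq_abs]
  have hle : ∫ x, (c / 4 * ((χ n x) ^ 2 * ‖G x‖ ^ 2)
      - ((2 * M + 1) * ‖Ψ x‖ ^ 2 + (1 + c⁻¹) * ‖F x‖ ^ 2)) ≤ 0 := by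
    rw [← h0]
    refine integral_mono_ae ((hχG.const_mul _).sub hKi) hi ?_
    filter_upwards [hcA, hM] with x h1 h2
    have h3 := inner_cutoff_lower_bound (t := χ n x) hc h1 h2 (G x) (F x) (φ x • ∇ (χ n) x)
    have e : (χ n x * χ n x) • G x + φ x • ∇ (fun x => χ n x * χ n x) x
        = χ n x ^ 2 • G x + (2 * χ n x) • (φ x • ∇ (χ n) x) := by
      rw [gradient_mul_apply ((hχ n).differentiable x) ((hχ n).differentiable x)]
      module
    rw [e]
    refine le_trans ?_ h3
    have h4 : ‖φ x • ∇ (χ n) x‖ ^ 2 ≤ ‖Ψ x‖ ^ 2 :=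
      pow_le_pow_left₀ (norm_nonneg _) ((hφΨ n hn x).trans (le_abs_self _)) 2
    have h5 : χ n x ^ 2 * ‖F x‖ ^ 2 ≤ ‖F x‖ ^ 2 :=
      mul_le_of_le_one_left (sq_nonneg _) (pow_le_one₀ (hχ0 n x) (hχ1 n x))
    have h6 := mul_le_mul_of_nonneg_left h4 (by positivity : 0 ≤ 2 * M + 1)
    have h7 := mul_le_mul_of_nonneg_left h5 (by positivity : 0 ≤ 1 + c⁻¹)
    linarith
  rw [integral_sub (hχG.const_mul _) hKi, integral_const_mul, ← hK] at hle
  calc ∫ x in Metric.ball 0 ((n : ℝ) + 1), ‖G x‖ ^ 2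
      = ∫ x in Metric.ball 0 ((n : ℝ) + 1), χ n x ^ 2 * ‖G x‖ ^ 2 := by
        refine setIntegral_congr_fun measurableSet_ball fun x hx => ?_
        rw [hχn n x (by simpa using hx)]
        ring
    _ ≤ ∫ x, χ n x ^ 2 * ‖G x‖ ^ 2 :=
        setIntegral_le_integral hχG (Eventually.of_forall fun x => by positivity)
    _ ≤ 4 / c * K := by
        rw [div_mul_eq_mul_div, le_div_iff₀ hc]
        linarith

/-- The energy identity: the weak equation may be tested with a decaying `φ'` itself. -/
theorem HasWeakGradient.integral_inner_decaying_eq_zero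
    (hA : AEStronglyMeasurable A) (hM : ∀ᵐ x, ‖A x‖ ≤ M) (hF : MemLp F 2)
    (hG : HasWeakGradient φ G) (hG' : HasWeakGradient φ' G') (hG2 : MemLp G 2) (hG2' : MemLp G' 2)
    (heq : ∀ v, IsTestFunction v → ∫ x, inner ℝ (A x • G x + F x) (∇ v x) = 0)
    (hχ : ∀ n, IsTestFunction (χ n)) (hχ0 : ∀ n x, 0 ≤ χ n x) (hχ1 : ∀ n x, χ n x ≤ 1)
    (hχn : ∀ (n : ℕ) x, ‖x‖ < n + 1 → χ n x = 1)
    (hχg : ∀ (n : ℕ) x, ‖x‖ < n + 1 → ∇ (χ n) x = 0) (hΨ : MemLp Ψ 2)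
    {N : ℕ} (hφΨ : ∀ n ≥ N, ∀ x, ‖φ' x • ∇ (χ n) x‖ ≤ Ψ x) :
    ∫ x, inner ℝ (A x • G x + F x) (G' x) = 0 := by
  have hH : MemLp (fun x => A x • G x + F x) 2 := (memLp_two_coeff_smul hA hM hG2).add hF
  have htest n := hG.integral_inner_smul_add_eq_zero hA hM hF hG' heq (hχ n)
  have hlim : Tendsto (fun n => ∫ x, inner ℝ (A x • G x + F x) (χ n x • G' x + φ' x • ∇ (χ n) x))
      atTop (𝓝 (∫ x, inner ℝ (A x • G x + F x) (G' x))) := by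
    refine tendsto_integral_filter_of_dominated_convergence
      (fun x => ‖A x • G x + F x‖ * (‖G' x‖ + Ψ x))
      (Eventually.of_forall fun n => (htest n).1.1) ?_ (hH.norm.integrable_mul (hG2'.norm.add hΨ))
      ?_
    · filter_upwards [eventually_ge_atTop N] with n hn
      refine Eventually.of_forall fun x => ?_
      refine (norm_inner_le_norm _ _).trans (mul_le_mul_of_nonneg_left ?_ (norm_nonneg _))
      refine (norm_add_le _ _).trans (add_le_add ?_ (hφΨ n hn x))
      rw [norm_smul, Real.norm_of_nonneg (hχ0 n x)]
      exact mul_le_of_le_one_left (norm_nonneg _) (hχ1 n x)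
    -- At each point the sequence is eventually constant, because the cutoff is `1` with zero
    -- gradient there.
    · refine Eventually.of_forall fun x => ?_
      obtain ⟨m, hm⟩ := exists_nat_gt ‖x‖
      refine tendsto_const_nhds.congr' ?_
      filter_upwards [eventually_ge_atTop m] with n hn
      have hn' : (m : ℝ) ≤ n := by exact_mod_cast hn
      rw [hχn n x (by linarith), hχg n x (by linarith)]
      simp
  simp_rw [(htest _).2] at hlim
  exact tendsto_nhds_unique hlim tendsto_const_nhds

/-! ### Freezing the coefficient at the center -/

/-- Blowing up at `x₀`, the uniform lower bound passes to the frozen coefficient. -/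
theorem ae_le_add_of_forall_scale {Ω : Set (EuclideanSpace ℝ (Fin d))} (hΩ : IsOpen Ω)
    {x₀ : EuclideanSpace ℝ (Fin d)} (hx₀ : x₀ ∈ Ω) {D₀ D₁ : EuclideanSpace ℝ (Fin d) → ℝ}
    (hD₀ : ContinuousAt D₀ x₀) {C₀ ε₀ : ℝ} (hε₀ : 0 < ε₀)
    (h : ∀ ε ∈ Set.Ioo 0 ε₀, ∀ᵐ x ∂(volume.restrict Ω),
      C₀ ≤ D₀ x + D₁ (ε⁻¹ • (x - x₀))) :
    ∀ᵐ y, C₀ ≤ D₀ x₀ + D₁ y := by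
  -- A countable family of scales leaves a single null set; the factor `1 / 2` keeps even `n = 0`
  -- strictly below `ε₀`.
  set ε : ℕ → ℝ := fun n => ε₀ / 2 * (1 / ((n : ℝ) + 1)) with hε
  have hεpos n : 0 < ε n := by positivity
  have hεlt n : ε n < ε₀ := by
    have h1 : 1 / ((n : ℝ) + 1) ≤ 1 := by
      rw [div_le_one (by positivity)]
      linarith [n.cast_nonneg (α := ℝ)]
    have : ε n ≤ ε₀ / 2 * 1 := mul_le_mul_of_nonneg_left h1 (by positivity)
    linarith
  have hεlim : Tendsto ε atTop (𝓝 0) := by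
    simpa [hε] using (tendsto_one_div_add_atTop_nhds_zero_nat (𝕜 := ℝ)).const_mul (ε₀ / 2)
  -- In the variable `y = (x - x₀) / ε` the term `D₁ y` no longer depends on the scale; translations
  -- and dilations preserve null sets.
  have hscale (n : ℕ) : ∀ᵐ y, x₀ + ε n • y ∈ Ω → C₀ ≤ D₀ (x₀ + ε n • y) + D₁ y := by
    have h1 := (ae_restrict_iff' hΩ.measurableSet).1 (h (ε n) ⟨hεpos n, hεlt n⟩)
    have h2 : ∀ᵐ z, x₀ + z ∈ Ω → C₀ ≤ D₀ (x₀ + z) + D₁ ((ε n)⁻¹ • (x₀ + z - x₀)) :=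
      (measurePreserving_add_left volume x₀).quasiMeasurePreserving.ae h1
    rw [ae_iff] at h2 ⊢
    have h3 := Measure.addHaar_preimage_smul volume (hεpos n).ne'
      {z | ¬(x₀ + z ∈ Ω → C₀ ≤ D₀ (x₀ + z) + D₁ ((ε n)⁻¹ • (x₀ + z - x₀)))}
    rw [h2, mul_zero] at h3
    rw [← h3]
    congr 1
    ext y
    simp [smul_smul, inv_mul_cancel₀ (hεpos n).ne']
  filter_upwards [ae_all_iff.2 hscale] with y hy
  have hlim : Tendsto (fun n => x₀ + ε n • y) atTop (𝓝 x₀) := by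
    simpa using tendsto_const_nhds.add (hεlim.smul_const y)
  refine ge_of_tendsto ((hD₀.tendsto.comp hlim).add_const (D₁ y)) ?_
  filter_upwards [hlim (hΩ.mem_nhds hx₀)] with n hn
  exact hy n hn

/-! ### Monomials and quadratic forms -/

theorem contDiff_monom (i : Fin d → ℕ) : ContDiff ℝ ∞ (monom i) :=
  contDiff_prod fun _ _ => (contDiff_piLp_apply _).pow _

theorem continuous_gradient_monom (i : Fin d → ℕ) : Continuous (∇ (monom i)) :=
  (InnerProductSpace.toDual ℝ _).symm.continuous.comp
    ((contDiff_monom i).continuous_fderiv (by simp))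

theorem gradient_sum_monom (I : Finset (Fin d → ℕ)) (α : (Fin d → ℕ) → ℝ)
    (x : EuclideanSpace ℝ (Fin d)) :
    ∇ (fun y => ∑ i ∈ I, α i * monom i y) x = ∑ i ∈ I, α i • ∇ (monom i) x := by
  have hd (i : Fin d → ℕ) : DifferentiableAt ℝ (monom i) x :=
    (contDiff_monom i).differentiable (by simp) x
  simp only [gradient]
  rw [fderiv_fun_sum fun i _ => (hd i).const_mul _, map_sum]
  refine Finset.sum_congr rfl fun i _ => ?_
  rw [fderiv_const_mul (hd i), map_smul]

theorem memLp_two_restrict_of_continuous {B : Set (EuclideanSpace ℝ (Fin d))}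
    (hB : Bornology.IsBounded B)
    {U : EuclideanSpace ℝ (Fin d) → EuclideanSpace ℝ (Fin d)} (hU : Continuous U) :
    MemLp U 2 (volume.restrict B) := by
  obtain ⟨R, hR⟩ := hB.subset_closedBall 0
  have hK := isCompact_closedBall (0 : EuclideanSpace ℝ (Fin d)) R
  obtain ⟨C, hC⟩ := hK.exists_bound_of_continuousOn hU.continuousOn
  have : IsFiniteMeasure
      (volume.restrict (Metric.closedBall (0 : EuclideanSpace ℝ (Fin d)) R)) :=
    ⟨by simpa using hK.measure_lt_top⟩
  refine (MemLp.of_bound hU.aestronglyMeasurable C ?_).mono_measure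
    (Measure.restrict_mono_set volume hR)
  exact (ae_restrict_iff' hK.measurableSet).2 (Eventually.of_forall hC)

theorem integrable_mul_inner_of_memLp {μ : Measure (EuclideanSpace ℝ (Fin d))}
    {b : EuclideanSpace ℝ (Fin d) → ℝ} {M : ℝ}
    {X Y : EuclideanSpace ℝ (Fin d) → EuclideanSpace ℝ (Fin d)}
    (hb : AEStronglyMeasurable b μ) (hM : ∀ᵐ x ∂μ, ‖b x‖ ≤ M)
    (hX : MemLp X 2 μ) (hY : MemLp Y 2 μ) :
    Integrable (fun x => b x * inner ℝ (X x) (Y x)) μ := by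
  simpa only [real_inner_smul_left] using
    integrable_inner_of_memLp (memLp_two_coeff_smul hb hM hX) hY

theorem sum_sum_mul_integral_inner {ι : Type*} {μ : Measure (EuclideanSpace ℝ (Fin d))}
    {b : EuclideanSpace ℝ (Fin d) → ℝ} {M : ℝ}
    {X Y : ι → EuclideanSpace ℝ (Fin d) → EuclideanSpace ℝ (Fin d)} (I : Finset ι) (α : ι → ℝ)
    (hb : AEStronglyMeasurable b μ) (hM : ∀ᵐ x ∂μ, ‖b x‖ ≤ M)
    (hX : ∀ i ∈ I, MemLp (X i) 2 μ) (hY : ∀ i ∈ I, MemLp (Y i) 2 μ) :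
    ∑ i ∈ I, ∑ j ∈ I, α i * α j * ∫ x, b x * inner ℝ (X i x) (Y j x) ∂μ
      = ∫ x, b x * inner ℝ (∑ i ∈ I, α i • X i x) (∑ i ∈ I, α i • Y i x) ∂μ := by
  have hi (i : ι) (h : i ∈ I) (j : ι) (h' : j ∈ I) :
      Integrable (fun x => α i * α j * (b x * inner ℝ (X i x) (Y j x))) μ :=
    (integrable_mul_inner_of_memLp hb hM (hX i h) (hY j h')).const_mul _
  simp_rw [← integral_const_mul]
  rw [Finset.sum_congr rfl fun i h => (integral_finsetSum I fun j h' => hi i h j h').symm,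
    ← integral_finsetSum I fun i h => integrable_finsetSum I fun j h' => hi i h j h']
  refine integral_congr_ae (Eventually.of_forall fun x => ?_)
  simp only [sum_inner, inner_sum, real_inner_smul_left, real_inner_smul_right, Finset.mul_sum]
  rw [Finset.sum_comm]
  refine Finset.sum_congr rfl fun i _ => Finset.sum_congr rfl fun j _ => ?_
  ring

/-- Expand `‖b • u + (a + b) • g‖² ≥ 0`, divide by `a + b`, and use `b - b² / (a + b) = a b / (a +
b)`. The sign of `b` is free, as needed for `D₁`. -/
theorem completed_square_bound {V : Type*} [NormedAddCommGroup V] [InnerProductSpace ℝ V]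
    {a b : ℝ} (hab : 0 < a + b) (u g : V) :
    a * b / (a + b) * ‖u‖ ^ 2
      ≤ b * inner ℝ u u + 2 * (b * inner ℝ u g) + (a + b) * inner ℝ g g := by
  have h := norm_add_sq_real (b • u) ((a + b) • g)
  rw [real_inner_smul_left, real_inner_smul_right, norm_smul, norm_smul, mul_pow, mul_pow,
    Real.norm_eq_abs, Real.norm_eq_abs, sq_abs, sq_abs] at h
  have h0 : 0 ≤ ‖b • u + (a + b) • g‖ ^ 2 := sq_nonneg _
  rw [h] at h0
  rw [real_inner_self_eq_norm_sq, real_inner_self_eq_norm_sq, div_mul_eq_mul_div,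
    div_le_iff₀ hab]
  linarith

end Inclusion

/-! ### Correctors and the polarization tensor -/

namespace Inclusion

variable {d : ℕ} {B : Set (EuclideanSpace ℝ (Fin d))} {a₀ c M : ℝ}
  {D₁ : EuclideanSpace ℝ (Fin d) → ℝ} {i j : Fin d → ℕ}
  {φ φ' : EuclideanSpace ℝ (Fin d) → ℝ}
  {G G' : EuclideanSpace ℝ (Fin d) → EuclideanSpace ℝ (Fin d)}

theorem memLp_two_indicator_smul_gradient_monom (hB : Bornology.IsBounded B)
    (hBm : MeasurableSet B) (hD₁ : AEStronglyMeasurable D₁) (hM : ∀ᵐ x, ‖D₁ x‖ ≤ M)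
    (j : Fin d → ℕ) : MemLp (B.indicator fun x => D₁ x • ∇ (monom j) x) 2 :=
  (memLp_indicator_iff_restrict hBm).2 <| memLp_two_coeff_smul hD₁.restrict (ae_restrict_of_ae hM)
    (memLp_two_restrict_of_continuous hB (continuous_gradient_monom j))

theorem integral_inner_indicator_smul (hBm : MeasurableSet B)
    (U V : EuclideanSpace ℝ (Fin d) → EuclideanSpace ℝ (Fin d)) :
    ∫ x, inner ℝ (B.indicator (fun x => D₁ x • U x) x) (V x)
      = ∫ x in B, D₁ x * inner ℝ (U x) (V x) := by
  rw [← integral_indicator hBm]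
  refine integral_congr_ae (Eventually.of_forall fun x => ?_)
  by_cases hx : x ∈ B
  · simp [hx, real_inner_smul_left]
  · simp [hx]

/-- Moves the right-hand side under one divergence, with the globally `L²` source `1_B D₁ ∇x^j`, the
form used by the energy estimates. -/
theorem IsCorrector.weak_equation (hB : Bornology.IsBounded B) (hBm : MeasurableSet B)
    (hD₁ : AEStronglyMeasurable D₁) (hM₁ : ∀ᵐ x, ‖D₁ x‖ ≤ M) (hM : ∀ᵐ x, ‖a₀ + D₁ x‖ ≤ c)
    (h : IsCorrector B a₀ D₁ j φ G) (v : EuclideanSpace ℝ (Fin d) → ℝ) (hv : IsTestFunction v) :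
    ∫ x, inner ℝ ((a₀ + D₁ x) • G x + B.indicator (fun x => D₁ x • ∇ (monom j) x) x) (∇ v x)
      = 0 := by
  have hF := memLp_two_indicator_smul_gradient_monom hB hBm hD₁ hM₁ j
  have hvg : ∀ K : Set (EuclideanSpace ℝ (Fin d)), IsCompact K →
      MemLp (∇ v) 2 (volume.restrict K) := fun K hK =>
    memLp_two_restrict_of_continuous hK.isBounded hv.continuous_gradient
  have i1 := integrable_inner_of_hasCompactSupport
    (fun K hK => memLp_two_coeff_smul (aestronglyMeasurable_const.add hD₁).restrict
      (ae_restrict_of_ae hM) (h.weakGradient.memLp_grad K hK)) hvg hv.hasCompactSupport_gradient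
  have i2 := integrable_inner_of_hasCompactSupport (fun K _ => hF.restrict K) hvg
    hv.hasCompactSupport_gradient
  simp_rw [inner_add_left]
  have e := integral_add i1 i2
  simp only [Pi.add_apply] at e
  rw [e, integral_inner_indicator_smul hBm, ← sub_eq_zero_of_eq (h.equation v hv), sub_neg_eq_add]
  simp_rw [real_inner_smul_left]

theorem IsCorrector.energy (hd : 0 < d) (hB : Bornology.IsBounded B) (hBm : MeasurableSet B)
    (hD₁ : AEStronglyMeasurable D₁) (hM₁ : ∀ᵐ x, ‖D₁ x‖ ≤ M) (hc : 0 < c)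
    (hcoer : ∀ᵐ x, c ≤ a₀ + D₁ x) (h : IsCorrector B a₀ D₁ i φ G)
    (h' : IsCorrector B a₀ D₁ j φ' G') :
    MemLp G 2 ∧ MemLp G' 2 ∧
      (∫ x, (a₀ + D₁ x) * inner ℝ (G x) (G' x))
        + ∫ x in B, D₁ x * inner ℝ (∇ (monom i) x) (G' x) = 0 := by
  have hA : AEStronglyMeasurable fun x => a₀ + D₁ x := aestronglyMeasurable_const.add hD₁
  have hM : ∀ᵐ x, ‖a₀ + D₁ x‖ ≤ ‖a₀‖ + M := by
    filter_upwards [hM₁] with x hx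
    exact (norm_add_le _ _).trans (by linarith)
  have hM' : ∀ᵐ x, a₀ + D₁ x ≤ ‖a₀‖ + M := hM.mono fun x hx => (le_abs_self _).trans hx
  have hF (k : Fin d → ℕ) := memLp_two_indicator_smul_gradient_monom hB hBm hD₁ hM₁ k
  obtain ⟨χ, C, hC, hχ, hχ0, hχ1, hχn, hχg, hχC⟩ := exists_cutoff d
  obtain ⟨C₁, N₁, hN₁⟩ := exists_bound_smul_gradient_cutoff hd h.decay hC hχg hχC
  obtain ⟨C₂, N₂, hN₂⟩ := exists_bound_smul_gradient_cutoff hd h'.decay hC hχg hχC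
  have hΨ (k : ℝ) := (memLp_inv_one_add_norm_pow hd).const_mul k
  have heq := h.weak_equation hB hBm hD₁ hM₁ hM
  have hG := h.weakGradient.memLp_two_grad hc hA hcoer hM' (hF i) heq hχ hχ0 hχ1 hχn (hΨ C₁) hN₁
  have hG' := h'.weakGradient.memLp_two_grad hc hA hcoer hM' (hF j)
    (h'.weak_equation hB hBm hD₁ hM₁ hM) hχ hχ0 hχ1 hχn (hΨ C₂) hN₂
  refine ⟨hG, hG', ?_⟩
  have h0 := h.weakGradient.integral_inner_decaying_eq_zero hA hM (hF i) h'.weakGradient hG hG'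
    heq hχ hχ0 hχ1 hχn hχg (hΨ C₂) hN₂
  have i1 := integrable_inner_of_memLp (memLp_two_coeff_smul hA hM hG) hG'
  have i2 := integrable_inner_of_memLp (hF i) hG'
  simp_rw [inner_add_left] at h0
  have e := integral_add i1 i2
  rw [← h0, e, integral_inner_indicator_smul hBm]
  simp_rw [real_inner_smul_left]

theorem polarization_bounds {d : ℕ} (hd : 0 < d) {B : Set (EuclideanSpace ℝ (Fin d))}
    (hB : Bornology.IsBounded B) (hBm : MeasurableSet B) {a₀ c M : ℝ}
    {D₁ : EuclideanSpace ℝ (Fin d) → ℝ} (hD₁ : AEStronglyMeasurable D₁)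
    (hM₁ : ∀ᵐ x, ‖D₁ x‖ ≤ M) (hc : 0 < c) (hcoer : ∀ᵐ x, c ≤ a₀ + D₁ x)
    (I : Finset (Fin d → ℕ)) (φ : (Fin d → ℕ) → EuclideanSpace ℝ (Fin d) → ℝ)
    (G : (Fin d → ℕ) → EuclideanSpace ℝ (Fin d) → EuclideanSpace ℝ (Fin d))
    (hφ : ∀ j ∈ I, IsCorrector B a₀ D₁ j (φ j) (G j)) :
    (∀ i ∈ I, ∀ j ∈ I, polarizationTensor B D₁ G i j = polarizationTensor B D₁ G j i) ∧
    ∀ α : (Fin d → ℕ) → ℝ,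
      ∫ x in B, a₀ * D₁ x / (a₀ + D₁ x) * ‖∇ (fun y => ∑ i ∈ I, α i * monom i y) x‖ ^ 2
        ≤ ∑ i ∈ I, ∑ j ∈ I, α i * α j * polarizationTensor B D₁ G i j ∧
      ∑ i ∈ I, ∑ j ∈ I, α i * α j * polarizationTensor B D₁ G i j
        ≤ ∫ x in B, D₁ x * ‖∇ (fun y => ∑ i ∈ I, α i * monom i y) x‖ ^ 2 := by
  have hA : AEStronglyMeasurable fun x => a₀ + D₁ x := aestronglyMeasurable_const.add hD₁
  have hM : ∀ᵐ x, ‖a₀ + D₁ x‖ ≤ ‖a₀‖ + M := by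
    filter_upwards [hM₁] with x hx
    exact (norm_add_le _ _).trans (by linarith)
  have hG (i) (hi : i ∈ I) : MemLp (G i) 2 :=
    ((hφ i hi).energy hd hB hBm hD₁ hM₁ hc hcoer (hφ i hi)).1
  have henergy (i) (hi : i ∈ I) (j) (hj : j ∈ I) :=
    ((hφ i hi).energy hd hB hBm hD₁ hM₁ hc hcoer (hφ j hj)).2.2
  have hU (i : Fin d → ℕ) : MemLp (∇ (monom i)) 2 (volume.restrict B) :=
    memLp_two_restrict_of_continuous hB (continuous_gradient_monom i)
  have hD₁B := hD₁.restrict (s := B)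
  have hM₁B := ae_restrict_of_ae (s := B) hM₁
  -- The energy identity replaces the mixed term `∫_B D₁ ∇x^i·∇φ_j` by a symmetric bilinear form.
  have htensor (i) (hi : i ∈ I) (j) (hj : j ∈ I) : polarizationTensor B D₁ G i j
      = (∫ x in B, D₁ x * inner ℝ (∇ (monom i) x) (∇ (monom j) x))
        - ∫ x, (a₀ + D₁ x) * inner ℝ (G i x) (G j x) := by
    rw [eq_neg_of_add_eq_zero_left (henergy i hi j hj), polarizationTensor, sub_neg_eq_add,
      ← integral_add (integrable_mul_inner_of_memLp hD₁B hM₁B (hU i) (hU j))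
        (integrable_mul_inner_of_memLp hD₁B hM₁B (hU i) ((hG j hj).restrict B))]
    refine integral_congr_ae (Eventually.of_forall fun x => ?_)
    beta_reduce
    rw [real_inner_comm, inner_add_right, mul_add]
  refine ⟨fun i hi j hj => ?_, fun α => ?_⟩
  · rw [htensor i hi j hj, htensor j hj i hi]
    simp only [real_inner_comm]
  set U : EuclideanSpace ℝ (Fin d) → EuclideanSpace ℝ (Fin d) :=
    fun x => ∑ i ∈ I, α i • ∇ (monom i) x with hUdef
  set Γ : EuclideanSpace ℝ (Fin d) → EuclideanSpace ℝ (Fin d) :=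
    fun x => ∑ i ∈ I, α i • G i x with hΓdef
  have hU2 : MemLp U 2 (volume.restrict B) :=
    memLp_finsetSum I fun i _ => (hU i).const_smul (α i)
  have hΓ2 : MemLp Γ 2 := memLp_finsetSum I fun i hi => (hG i hi).const_smul (α i)
  have hsum : ∑ i ∈ I, ∑ j ∈ I, α i * α j * polarizationTensor B D₁ G i j
      = (∫ x in B, D₁ x * inner ℝ (U x) (U x)) - ∫ x, (a₀ + D₁ x) * inner ℝ (Γ x) (Γ x) := by
    rw [← sum_sum_mul_integral_inner I α hD₁B hM₁B (fun i _ => hU i) (fun i _ => hU i),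
      ← sum_sum_mul_integral_inner I α hA hM hG hG, ← Finset.sum_sub_distrib]
    refine Finset.sum_congr rfl fun i hi => ?_
    rw [← Finset.sum_sub_distrib]
    refine Finset.sum_congr rfl fun j hj => ?_
    rw [htensor i hi j hj, mul_sub]
  have hEn : (∫ x, (a₀ + D₁ x) * inner ℝ (Γ x) (Γ x))
      + ∫ x in B, D₁ x * inner ℝ (U x) (Γ x) = 0 := by
    rw [← sum_sum_mul_integral_inner I α hA hM hG hG,
      ← sum_sum_mul_integral_inner I α hD₁B hM₁B (fun i _ => hU i)
        (fun i hi => (hG i hi).restrict B), ← Finset.sum_add_distrib]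
    refine Finset.sum_eq_zero fun i hi => ?_
    rw [← Finset.sum_add_distrib]
    refine Finset.sum_eq_zero fun j hj => ?_
    rw [← mul_add, henergy i hi j hj, mul_zero]
  have hnonneg : 0 ≤ᵐ[volume] fun x => (a₀ + D₁ x) * inner ℝ (Γ x) (Γ x) := by
    filter_upwards [hcoer] with x hx
    exact mul_nonneg (hc.le.trans hx) real_inner_self_nonneg
  simp_rw [gradient_sum_monom]
  rw [hsum]
  constructor
  · have iUU := integrable_mul_inner_of_memLp hD₁B hM₁B hU2 hU2
    have iUΓ := (integrable_mul_inner_of_memLp hD₁B hM₁B hU2 (hΓ2.restrict B)).const_mul 2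
    have iΓΓ := integrable_mul_inner_of_memLp hA hM hΓ2 hΓ2
    have hlow : ∫ x in B, a₀ * D₁ x / (a₀ + D₁ x) * ‖U x‖ ^ 2
        ≤ ∫ x in B, (D₁ x * inner ℝ (U x) (U x) + 2 * (D₁ x * inner ℝ (U x) (Γ x))
          + (a₀ + D₁ x) * inner ℝ (Γ x) (Γ x)) := by
      refine integral_mono_ae ?_ ((iUU.add iUΓ).add iΓΓ.restrict) ?_
      · have hb : AEStronglyMeasurable (fun x => a₀ * D₁ x / (a₀ + D₁ x)) (volume.restrict B) :=
          (((hD₁.aemeasurable.const_mul a₀).div hA.aemeasurable).aestronglyMeasurable).restrict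
        have hbM : ∀ᵐ x ∂(volume.restrict B), ‖a₀ * D₁ x / (a₀ + D₁ x)‖ ≤ ‖a₀‖ * M / c := by
          filter_upwards [hM₁B, ae_restrict_of_ae (s := B) hcoer] with x h1 h2
          rw [norm_div, norm_mul]
          have h3 : c ≤ ‖a₀ + D₁ x‖ := h2.trans (le_abs_self _)
          have h4 : 0 ≤ M := (norm_nonneg _).trans h1
          gcongr
        simpa only [real_inner_self_eq_norm_sq] using integrable_mul_inner_of_memLp hb hbM hU2 hU2
      · filter_upwards [ae_restrict_of_ae (s := B) hcoer] with x hx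
        exact completed_square_bound (hc.trans_le hx) (U x) (Γ x)
    -- The energy of `Γ` outside `B` is nonnegative and is discarded.
    have hle := setIntegral_le_integral (s := B) iΓΓ hnonneg
    have e1 := integral_add (iUU.add iUΓ) (iΓΓ.restrict (s := B))
    simp only [Pi.add_apply] at e1
    rw [e1, integral_add iUU iUΓ, integral_const_mul] at hlow
    change ∫ x in B, a₀ * D₁ x / (a₀ + D₁ x) * ‖U x‖ ^ 2 ≤ _
    -- With `E = ∫ A|Γ|²`, `hEn` gives `-E = E + 2 ∫_B D₁ U·Γ`, which produces the integrand of the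
    -- completed square.
    linarith
  · have h0 := integral_nonneg_of_ae hnonneg
    simp only [real_inner_self_eq_norm_sq] at h0 ⊢
    linarith

end Inclusion

/-! ### Assembly from the original hypotheses -/

theorem proposition2p7 {d : ℕ} (hd : 2 ≤ d)
    -- the background: a domain `Ω`, a point `x₀` in it, and a smooth positive coefficient `D₀`
    (Ω : Set (EuclideanSpace ℝ (Fin d))) (hΩ : IsOpen Ω)
    (x₀ : EuclideanSpace ℝ (Fin d)) (hx₀ : x₀ ∈ Ω)
    (D₀ : EuclideanSpace ℝ (Fin d) → ℝ) (hD₀ : ContDiffOn ℝ ∞ D₀ (closure Ω))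
    (C₀' : ℝ) (hC₀' : 0 < C₀') (hD₀_pos : ∀ x ∈ closure Ω, C₀' ≤ D₀ x)
    -- the inclusion: a bounded set `B` and a bounded perturbation `D₁` vanishing outside it
    (B : Set (EuclideanSpace ℝ (Fin d))) (hB : Bornology.IsBounded B)
    (hBm : MeasurableSet B)
    (D₁ : EuclideanSpace ℝ (Fin d) → ℝ) (hD₁ : MemLp D₁ ⊤ volume)
    (hD₁_supp : ∀ᵐ x, x ∉ closure B → D₁ x = 0)
    -- the perturbed coefficient is bounded below, uniformly in the size `ε` of the inclusion
    (C₀ : ℝ) (hC₀ : 0 < C₀) (ε₀ : ℝ) (hε₀ : 0 < ε₀)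
    (hcoer : ∀ ε ∈ Set.Ioo 0 ε₀, ∀ᵐ x ∂(volume.restrict Ω),
      C₀ ≤ D₀ x + D₁ (ε⁻¹ • (x - x₀)))
    -- a finite set of multi-indices and the correctors
    (I : Finset (Fin d → ℕ))
    (φ : (Fin d → ℕ) → EuclideanSpace ℝ (Fin d) → ℝ)
    (G : (Fin d → ℕ) → EuclideanSpace ℝ (Fin d) → EuclideanSpace ℝ (Fin d))
    (hφ : ∀ j ∈ I, Inclusion.IsCorrector B (D₀ x₀) D₁ j (φ j) (G j)) :
    (∀ α β : (Fin d → ℕ) → ℝ,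
      ∑ i ∈ I, ∑ j ∈ I, α i * β j * Inclusion.polarizationTensor B D₁ G i j
        = ∑ i ∈ I, ∑ j ∈ I, α i * β j * Inclusion.polarizationTensor B D₁ G j i) ∧
    (∀ α : (Fin d → ℕ) → ℝ,
      ∫ x in B, D₀ x₀ * D₁ x / (D₀ x₀ + D₁ x) *
          ‖∇ (fun y => ∑ i ∈ I, α i * Inclusion.monom i y) x‖ ^ 2
        ≤ ∑ i ∈ I, ∑ j ∈ I, α i * α j * Inclusion.polarizationTensor B D₁ G i j ∧
      ∑ i ∈ I, ∑ j ∈ I, α i * α j * Inclusion.polarizationTensor B D₁ G i j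
        ≤ ∫ x in B, D₁ x * ‖∇ (fun y => ∑ i ∈ I, α i * Inclusion.monom i y) x‖ ^ 2) := by
  -- Smoothness is relative to `closure Ω`; being a neighborhood of `x₀`, it yields genuine
  -- continuity there.
  have hΩ₀ : closure Ω ∈ 𝓝 x₀ := mem_of_superset (hΩ.mem_nhds hx₀) subset_closure
  have hcoer' := Inclusion.ae_le_add_of_forall_scale hΩ hx₀
    (hD₀.continuousOn.continuousAt hΩ₀) hε₀ hcoer
  have hD₁_bdd : ∀ᵐ x, ‖D₁ x‖ ≤ (eLpNorm D₁ ⊤ volume).toReal := by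
    filter_upwards [ae_le_eLpNormEssSup (f := D₁) (μ := volume)] with x hx
    rw [← toReal_enorm]
    exact ENNReal.toReal_mono hD₁.2.ne (by rwa [eLpNorm_exponent_top])
  obtain ⟨hsymm, hbounds⟩ := Inclusion.polarization_bounds (by omega) hB hBm hD₁.1 hD₁_bdd hC₀
    hcoer' I φ G hφ
  refine ⟨fun α β => ?_, hbounds⟩
  refine Finset.sum_congr rfl fun i hi => Finset.sum_congr rfl fun j hj => ?_
  rw [hsymm i hi j hj]
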